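/- Let $N\ge 1$, let $\Omega\subset\mathbb{R}^N$ be a bounded domain with smooth boundary $\Gamma$, let $\omega\subset\Omega$ be open, let $T>0$, and put $Q=\Omega\times(0,T)$. Let $\chi_\omega$ be the characteristic function of $\omega$, and let $$M_2=\big\{\,y(T)\in L^2(\Omega)\;\big|\; y \text{ solves } y_t-\Delta y=\chi_\omega u \text{ in } Q,\ y=0 \text{ on } \Gamma\times(0,T),\ y(0)=0 \text{ in } \Omega,\ \text{for some } u\in L^2(Q) \text{ with } \|u\|_{L^2(Q)}\le 1\,\big\},$$ where solutions are weak solutions in $C([0,T];L^2(\Omega))\cap L^2(0,T;H^1_0(\Omega))$. A subset $M$ of a Hilbert space $Y$ is called finite codimensional in $Y$ if there is $x_0\in\overline{\mathrm{co}}\,M$ such that the closed linear span of $M-\{x_0\}$ is a subspace of finite codimension in $Y$, and $\overline{\mathrm{co}}(M-\{x_0\})$ has at least one interior point relative to this subspace. (Here $\overline{\mathrm{co}}$ denotes the closed convex hull.) Then $M_2$ is not finite codimensional in $L^2(\Omega)$. -/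

import Mathlib

open MeasureTheory Set TopologicalSpace
open scoped Pointwise Distributions

/-- The closed linear span of a subset of a normed space. -/
def closedSpan {Y : Type*} [NormedAddCommGroup Y] [NormedSpace ℝ Y] (D : Set Y) :
    Submodule ℝ Y :=
  (Submodule.span ℝ D).topologicalClosure

/-- A set `M` of a normed space `Y` is finite codimensional in `Y` if there is a point `x₀` of the
closed convex hull of `M` such that the closed linear span of `M - {x₀}` has finite codimension
in `Y`, and the closed convex hull of `M - {x₀}` has an interior point relative to this span. -/
def IsFiniteCodimensional {Y : Type*} [NormedAddCommGroup Y] [NormedSpace ℝ Y]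
    (M : Set Y) : Prop :=
  ∃ x₀ ∈ closedConvexHull ℝ M,
    FiniteDimensional ℝ (Y ⧸ closedSpan (M - ({x₀} : Set Y))) ∧
    (interior {s : closedSpan (M - ({x₀} : Set Y)) |
      (s : Y) ∈ closedConvexHull ℝ (M - ({x₀} : Set Y))}).Nonempty

/-- The open set `Ω` has a smooth boundary: near each boundary point, `Ω` is the set where some
smooth function with nonvanishing differential is negative. -/
def HasSmoothBoundary {N : ℕ} (Ω : Opens (EuclideanSpace ℝ (Fin N))) : Prop :=
  ∀ x ∈ frontier (Ω : Set (EuclideanSpace ℝ (Fin N))),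
    ∃ U : Set (EuclideanSpace ℝ (Fin N)), IsOpen U ∧ x ∈ U ∧
      ∃ ρ : EuclideanSpace ℝ (Fin N) → ℝ, ContDiffOn ℝ ((⊤ : ℕ∞) : WithTop ℕ∞) ρ U ∧
        (∀ z ∈ U, fderiv ℝ ρ z ≠ 0) ∧
        (Ω : Set (EuclideanSpace ℝ (Fin N))) ∩ U = {z ∈ U | ρ z < 0}

/-- The space `L²(Ω)` of real functions. -/
abbrev LTwo {N : ℕ} (Ω : Opens (EuclideanSpace ℝ (Fin N))) : Type :=
  Lp ℝ 2 (volume.restrict (Ω : Set (EuclideanSpace ℝ (Fin N))))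

/-- The space `L²(Ω; ℝᴺ)` of vector fields. -/
abbrev LTwoField {N : ℕ} (Ω : Opens (EuclideanSpace ℝ (Fin N))) : Type :=
  Lp (EuclideanSpace ℝ (Fin N)) 2 (volume.restrict (Ω : Set (EuclideanSpace ℝ (Fin N))))

/-- The space-time cylinder `Ω × (0, t)`. -/
def spaceTimeCylinder {N : ℕ} (Ω : Opens (EuclideanSpace ℝ (Fin N))) (t : ℝ) :
    Set (EuclideanSpace ℝ (Fin N) × ℝ) :=
  (Ω : Set (EuclideanSpace ℝ (Fin N))) ×ˢ Ioo 0 t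

/-- The space `L²(Q)` with `Q = Ω × (0, T)`. -/
abbrev LTwoCylinder {N : ℕ} (Ω : Opens (EuclideanSpace ℝ (Fin N))) (T : ℝ) : Type :=
  Lp ℝ 2 (volume.restrict (spaceTimeCylinder Ω T))

/-- The Sobolev space `H¹₀(Ω)`, as the set of the pairs `(v, ∇v)`: the closure in
`L²(Ω) × L²(Ω; ℝᴺ)` of the pairs `(φ, ∇φ)` with `φ` a smooth function of compact support in `Ω`. -/
def HOneZero {N : ℕ} (Ω : Opens (EuclideanSpace ℝ (Fin N))) : Set (LTwo Ω × LTwoField Ω) :=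
  closure {p | ∃ φ : 𝓓(Ω, ℝ),
    p.1 =ᵐ[volume.restrict (Ω : Set (EuclideanSpace ℝ (Fin N)))] (fun x => φ x) ∧
    p.2 =ᵐ[volume.restrict (Ω : Set (EuclideanSpace ℝ (Fin N)))] (fun x => gradient (fun z => φ z) x)}

/-- `y` is the (weak) solution, of class `C([0, T]; L²(Ω)) ∩ L²(0, T; H¹₀(Ω))`, of
`y_t - Δy = χ_ω u` in `Ω × (0, T)`, `y = 0` on `∂Ω × (0, T)`, `y(0) = y₀`. The curve `G` is the
spatial gradient of `y`; the equation is tested against all `v ∈ H¹₀(Ω)` (with gradient `g`)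
and integrated over `(0, t)`. -/
structure IsHeatSolution {N : ℕ} (Ω : Opens (EuclideanSpace ℝ (Fin N)))
    (ω : Set (EuclideanSpace ℝ (Fin N))) (T : ℝ) (u : LTwoCylinder Ω T) (y₀ : LTwo Ω)
    (y : ℝ → LTwo Ω) : Prop where
  continuousOn : ContinuousOn y (Icc 0 T)
  initial : y 0 = y₀
  weak : ∃ G : ℝ → LTwoField Ω,
    MemLp G 2 (volume.restrict (Ioo 0 T)) ∧
    (∀ᵐ t ∂(volume.restrict (Ioo 0 T)), (y t, G t) ∈ HOneZero Ω) ∧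
    ∀ v : LTwo Ω, ∀ g : LTwoField Ω, (v, g) ∈ HOneZero Ω → ∀ t ∈ Icc 0 T,
      inner ℝ (y t) v - inner ℝ y₀ v + ∫ s in (0 : ℝ)..t, inner ℝ (G s) g =
        ∫ p in spaceTimeCylinder Ω t, ω.indicator (fun _ => (1 : ℝ)) p.1 * u p * v p.1

/-- The set of the endpoints `y(T)` of the controlled heat equation with zero initial datum and
controls `u` in the closed unit ball of `L²(Q)`. -/
def heatReachableUnitBall {N : ℕ} (Ω : Opens (EuclideanSpace ℝ (Fin N)))
    (ω : Set (EuclideanSpace ℝ (Fin N))) (T : ℝ) : Set (LTwo Ω) :=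
  {z | ∃ u : LTwoCylinder Ω T, ‖u‖ ≤ 1 ∧
    ∃ y : ℝ → LTwo Ω, IsHeatSolution Ω ω T u 0 y ∧ y T = z}

section

open Filter Topology

variable {N : ℕ} {Ω : Opens (EuclideanSpace ℝ (Fin N))}

/-! If `M` is finite codimensional, a translate of its closed convex hull contains a ball of a
closed subspace `K` around some point, and `Kᗮ` is finite dimensional. A weakly null sequence whose
pairings with `M` tend to zero uniformly is then strongly null: the ball controls the `K`-component,
weak convergence the `Kᗮ`-component (`IsFiniteCodimensional.tendsto_norm_sq`).

Smoothing by the heat flow contradicts this. Let `v n = a(x) cos(n⟨e,x⟩ + θ)` with a fixed nonzero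
test function `a` and a unit vector `e`. It is weakly null by Riemann–Lebesgue, but the squared
norms for the phases `0` and `-π/2` add up to `‖a‖²`.

It remains to see that reachable states pair with `v n` as `O(1/n)`, uniformly in the control.
Formally `h = ⟨y, v n⟩` satisfies `h' = β - n² h + r`, with `β` the source and `r = ⟨y, Δ(v n) + n²
v n⟩`; the damping `n²` yields `IsHeatSolution.sq_inner_add_integral_le`. The residual contains a
term of order `n` with amplitude `∂ₑa`, so the estimate is used twice: for the amplitude `∂ₑa`, with
a crude bound on `r`, to gain `1/n` in mean square over time, then for `a` at time `T`. -/

/-! ### Integrals of a function against its primitive -/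

/-- The kernel `⟨G s, G t⟩` is symmetric, so a triangle carries half of its integral over the
square. -/
theorem integral_integral_inner_primitive {H : Type*} [NormedAddCommGroup H]
    [InnerProductSpace ℝ H] [CompleteSpace H] {T : ℝ} {G : ℝ → H}
    (hG : Integrable G (volume.restrict (Ioo 0 T))) :
    Integrable (fun t => ∫ s in (0 : ℝ)..t, inner ℝ (G s) (G t)) (volume.restrict (Ioo 0 T)) ∧
    ∫ t in Ioo 0 T, ∫ s in (0 : ℝ)..t, inner ℝ (G s) (G t) = ‖∫ t in Ioo 0 T, G t‖ ^ 2 / 2 := by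
  set μ := volume.restrict (Ioo 0 T) with hμ
  set K : ℝ × ℝ → ℝ := fun p => inner ℝ (G p.1) (G p.2) with hK
  have hKi : Integrable K (μ.prod μ) := by
    have h1 : AEStronglyMeasurable K (μ.prod μ) :=
      hG.aestronglyMeasurable.comp_fst.inner hG.aestronglyMeasurable.comp_snd
    refine (hG.norm.mul_prod hG.norm).mono' h1 (ae_of_all _ fun p => ?_)
    exact norm_inner_le_norm _ _
  have hlt : MeasurableSet {p : ℝ × ℝ | p.1 < p.2} := measurableSet_lt measurable_fst measurable_snd
  have hle : MeasurableSet {p : ℝ × ℝ | p.1 ≤ p.2} := measurableSet_le measurable_fst measurable_snd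
  have f1 : ∀ᵐ t ∂μ, ∫ s in (0 : ℝ)..t, inner ℝ (G s) (G t) =
      ∫ s, {p : ℝ × ℝ | p.1 < p.2}.indicator K (s, t) ∂μ := by
    filter_upwards [ae_restrict_mem measurableSet_Ioo] with t ht
    have : (fun s => {p : ℝ × ℝ | p.1 < p.2}.indicator K (s, t)) =
        (Iio t).indicator (fun s => inner ℝ (G s) (G t)) := by
      ext s; simp [indicator, hK]
    rw [this, integral_indicator measurableSet_Iio, hμ, Measure.restrict_restrict measurableSet_Iio,
      intervalIntegral.integral_of_le ht.1.le, integral_Ioc_eq_integral_Ioo]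
    congr 2
    ext s; simp only [mem_Ioo, mem_inter_iff, mem_Iio]
    exact ⟨fun h => ⟨h.2, h.1, h.2.trans ht.2⟩, fun h => ⟨h.2.1, h.1⟩⟩
  have f2 : ∀ᵐ t ∂μ, ∫ s in (0 : ℝ)..t, inner ℝ (G s) (G t) =
      ∫ s, {p : ℝ × ℝ | p.1 ≤ p.2}.indicator K (s, t) ∂μ := by
    filter_upwards [ae_restrict_mem measurableSet_Ioo] with t ht
    have : (fun s => {p : ℝ × ℝ | p.1 ≤ p.2}.indicator K (s, t)) =
        (Iic t).indicator (fun s => inner ℝ (G s) (G t)) := by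
      ext s; simp [indicator, hK]
    rw [this, integral_indicator measurableSet_Iic, hμ, Measure.restrict_restrict measurableSet_Iic,
      intervalIntegral.integral_of_le ht.1.le]
    congr 2
    ext s; simp only [mem_Ioo, mem_Ioc, mem_inter_iff, mem_Iic]
    exact ⟨fun h => ⟨h.2, h.1, h.2.trans_lt ht.2⟩, fun h => ⟨h.2.1, h.1⟩⟩
  have i1 := integral_prod_symm _ (hKi.indicator hlt)
  have i2 := integral_prod_symm _ (hKi.indicator hle)
  rw [← integral_congr_ae f1] at i1
  rw [← integral_congr_ae f2] at i2
  refine ⟨((hKi.indicator hlt).integral_prod_right).congr (f1.mono fun _ h => h.symm), ?_⟩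
  -- Swapping coordinates turns the complement of the open triangle into the closed one. By `f1` and
  -- `f2` both triangles give the same iterated integral, so each carries half.
  have i3 : ∫ p, {p : ℝ × ℝ | p.1 < p.2}ᶜ.indicator K p ∂(μ.prod μ) =
      ∫ p, {p : ℝ × ℝ | p.1 ≤ p.2}.indicator K p ∂(μ.prod μ) := by
    rw [← integral_prod_swap]
    congr 1
    ext p
    simp only [indicator, mem_compl_iff, mem_ofPred_eq, not_lt, Prod.fst_swap, Prod.snd_swap, hK]
    rw [real_inner_comm]
  have i4 : ∫ p, K p ∂(μ.prod μ) = ‖∫ t, G t ∂μ‖ ^ 2 := by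
    rw [integral_prod _ hKi, ← real_inner_self_eq_norm_sq]
    simp_rw [hK, integral_inner hG]
    conv_lhs => enter [2, x]; rw [real_inner_comm]
    rw [integral_inner hG]
  have i5 := integral_add (hKi.indicator hlt) (hKi.indicator hlt.compl)
  have i6 : ∀ p, {p : ℝ × ℝ | p.1 < p.2}.indicator K p + {p : ℝ × ℝ | p.1 < p.2}ᶜ.indicator K p
      = K p := fun p => congrFun (indicator_self_add_compl _ K) p
  simp_rw [i6] at i5
  linarith

/-- The scalar case replaces `h h' = (h²)'/2` when `h'` is merely integrable. -/
theorem integral_primitive_mul {T : ℝ} {k : ℝ → ℝ}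
    (hk : Integrable k (volume.restrict (Ioo 0 T))) :
    ∫ t in Ioo 0 T, (∫ s in (0 : ℝ)..t, k s) * k t = (∫ t in Ioo 0 T, k t) ^ 2 / 2 := by
  have h := (integral_integral_inner_primitive hk).2
  simp only [Real.norm_eq_abs, sq_abs] at h
  rw [← h]
  congr 1
  ext t
  rw [← intervalIntegral.integral_mul_const]
  simp [mul_comm]


/-! ### Test functions and integration by parts against `HOneZero` -/

/-- Smooth functions with compact support in `Ω`. -/
structure IsTest (Ω : Opens (EuclideanSpace ℝ (Fin N))) (a : EuclideanSpace ℝ (Fin N) → ℝ) :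
    Prop where
  contDiff : ContDiff ℝ ((⊤ : ℕ∞) : WithTop ℕ∞) a
  hasCompactSupport : HasCompactSupport a
  tsupport_subset : tsupport a ⊆ Ω

/-- The directional derivative. -/
noncomputable def dirDeriv (e : EuclideanSpace ℝ (Fin N)) (a : EuclideanSpace ℝ (Fin N) → ℝ) :
    EuclideanSpace ℝ (Fin N) → ℝ := fun x => fderiv ℝ a x e

/-- The sum of the pure second derivatives along the coordinate axes. -/
noncomputable def laplace (a : EuclideanSpace ℝ (Fin N) → ℝ) : EuclideanSpace ℝ (Fin N) → ℝ :=
  fun x => ∑ i, dirDeriv (EuclideanSpace.basisFun (Fin N) ℝ i)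
    (dirDeriv (EuclideanSpace.basisFun (Fin N) ℝ i) a) x

namespace IsTest

variable {a b : EuclideanSpace ℝ (Fin N) → ℝ}

theorem differentiable (ha : IsTest Ω a) : Differentiable ℝ a :=
  ha.contDiff.differentiable (by simp)

theorem continuous (ha : IsTest Ω a) : Continuous a := ha.contDiff.continuous

theorem of_tsupport_subset (ha : IsTest Ω a) (hb : ContDiff ℝ ((⊤ : ℕ∞) : WithTop ℕ∞) b)
    (h : tsupport b ⊆ tsupport a) : IsTest Ω b :=
  ⟨hb, ha.hasCompactSupport.mono' (subset_closure.trans h), h.trans ha.tsupport_subset⟩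

theorem dirDeriv (ha : IsTest Ω a) (e : EuclideanSpace ℝ (Fin N)) : IsTest Ω (dirDeriv e a) :=
  ha.of_tsupport_subset ((ha.contDiff.fderiv_right (m := ((⊤ : ℕ∞) : WithTop ℕ∞)) (by simp)).clm_apply
    contDiff_const) (tsupport_fderiv_apply_subset ℝ e)

theorem mul_right (ha : IsTest Ω a) (hb : ContDiff ℝ ((⊤ : ℕ∞) : WithTop ℕ∞) b) :
    IsTest Ω (fun x => a x * b x) :=
  ha.of_tsupport_subset (ha.contDiff.mul hb) (tsupport_mul_subset_left)

theorem add (ha : IsTest Ω a) (hb : IsTest Ω b) : IsTest Ω (fun x => a x + b x) :=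
  ⟨ha.contDiff.add hb.contDiff, ha.hasCompactSupport.add hb.hasCompactSupport,
    (tsupport_add a b).trans (union_subset ha.tsupport_subset hb.tsupport_subset)⟩

theorem zero : IsTest Ω (fun _ => 0) :=
  ⟨contDiff_const, HasCompactSupport.zero, by
    rw [show (fun _ : EuclideanSpace ℝ (Fin N) => (0 : ℝ)) = 0 from rfl, tsupport_zero]
    exact empty_subset _⟩

theorem sum {ι : Type*} (s : Finset ι) {f : ι → EuclideanSpace ℝ (Fin N) → ℝ}
    (hf : ∀ i ∈ s, IsTest Ω (f i)) : IsTest Ω (fun x => ∑ i ∈ s, f i x) := by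
  classical
  induction s using Finset.induction_on with
  | empty => simpa using zero
  | insert i s hi ih =>
    simp_rw [Finset.sum_insert hi]
    exact (hf i (by simp)).add (ih fun j hj => hf j (by simp [hj]))

theorem laplace (ha : IsTest Ω a) : IsTest Ω (laplace a) :=
  sum _ fun _ _ => (ha.dirDeriv _).dirDeriv _

theorem const_mul (ha : IsTest Ω a) (c : ℝ) : IsTest Ω (fun x => c * a x) := by
  simpa [mul_comm] using ha.mul_right (b := fun _ => c) contDiff_const

theorem memLp_univ (ha : IsTest Ω a) : MemLp a 2 volume :=
  ha.continuous.memLp_of_hasCompactSupport ha.hasCompactSupport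

theorem memLp (ha : IsTest Ω a) :
    MemLp a 2 (volume.restrict (Ω : Set (EuclideanSpace ℝ (Fin N)))) :=
  ha.memLp_univ.restrict _

theorem eq_zero_of_notMem (ha : IsTest Ω a) {x : EuclideanSpace ℝ (Fin N)} (hx : x ∉ Ω) :
    a x = 0 :=
  image_eq_zero_of_notMem_tsupport fun h => hx (ha.tsupport_subset h)

theorem integrable_mul (ha : IsTest Ω a) (hb : IsTest Ω b) : Integrable (fun x => a x * b x) :=
  (ha.memLp_univ.integrable_mul hb.memLp_univ)

/-- The class of a test function in `L²(Ω)`. -/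
noncomputable def toL2 (ha : IsTest Ω a) : LTwo Ω := ha.memLp.toLp a

theorem coeFn_toL2 (ha : IsTest Ω a) :
    ha.toL2 =ᵐ[volume.restrict (Ω : Set (EuclideanSpace ℝ (Fin N)))] a := ha.memLp.coeFn_toLp

theorem _root_.gradient_eq_sum_dirDeriv {a : EuclideanSpace ℝ (Fin N) → ℝ} (x : EuclideanSpace ℝ (Fin N)) :
    gradient a x = ∑ i, _root_.dirDeriv (EuclideanSpace.basisFun (Fin N) ℝ i) a x •
      EuclideanSpace.basisFun (Fin N) ℝ i := by
  conv_lhs => rw [← (EuclideanSpace.basisFun (Fin N) ℝ).sum_repr' (gradient a x)]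
  refine Finset.sum_congr rfl fun i _ => ?_
  rw [real_inner_comm, inner_gradient_left]; rfl

theorem memLp_gradient (ha : IsTest Ω a) :
    MemLp (gradient a) 2 (volume.restrict (Ω : Set (EuclideanSpace ℝ (Fin N)))) := by
  have : gradient a = fun x => ∑ i, _root_.dirDeriv (EuclideanSpace.basisFun (Fin N) ℝ i) a x •
      EuclideanSpace.basisFun (Fin N) ℝ i := funext (gradient_eq_sum_dirDeriv)
  rw [this]
  refine memLp_finsetSum _ fun i _ => ?_
  exact (ContinuousLinearMap.toSpanSingleton ℝ (EuclideanSpace.basisFun (Fin N) ℝ i)).comp_memLp'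
    (ha.dirDeriv _).memLp

/-- The class of the gradient of a test function. -/
noncomputable def gradL2 (ha : IsTest Ω a) : LTwoField Ω := ha.memLp_gradient.toLp (gradient a)

theorem coeFn_gradL2 (ha : IsTest Ω a) :
    ha.gradL2 =ᵐ[volume.restrict (Ω : Set (EuclideanSpace ℝ (Fin N)))] gradient a :=
  ha.memLp_gradient.coeFn_toLp

theorem mem_HOneZero (ha : IsTest Ω a) : (ha.toL2, ha.gradL2) ∈ HOneZero Ω :=
  subset_closure ⟨⟨a, ha.contDiff, ha.hasCompactSupport, ha.tsupport_subset⟩,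
    ha.coeFn_toL2, ha.coeFn_gradL2⟩

theorem _root_.TestFunction.isTest (φ : 𝓓(Ω, ℝ)) : IsTest Ω (fun x => φ x) :=
  ⟨φ.contDiff, φ.hasCompactSupport, φ.tsupport_subset⟩

theorem integral_inner_gradient (ha : IsTest Ω a) (hb : IsTest Ω b) :
    ∫ x, inner ℝ (gradient a x) (gradient b x) = -∫ x, a x * _root_.laplace b x := by
  have h1 : ∀ x, inner ℝ (gradient a x) (gradient b x) =
      ∑ i, _root_.dirDeriv (EuclideanSpace.basisFun (Fin N) ℝ i) a x *
        _root_.dirDeriv (EuclideanSpace.basisFun (Fin N) ℝ i) b x := fun x => by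
    rw [← (EuclideanSpace.basisFun (Fin N) ℝ).sum_inner_mul_inner]
    refine Finset.sum_congr rfl fun i _ => ?_
    rw [real_inner_comm (gradient b x), inner_gradient_left, inner_gradient_left]; rfl
  simp_rw [h1, _root_.laplace, Finset.mul_sum]
  rw [integral_finsetSum _ fun i _ => (ha.dirDeriv _).integrable_mul (hb.dirDeriv _),
    integral_finsetSum _ fun i _ => ha.integrable_mul ((hb.dirDeriv _).dirDeriv _),
    ← Finset.sum_neg_distrib]
  refine Finset.sum_congr rfl fun i _ => ?_
  rw [eq_neg_iff_add_eq_zero, add_comm, ← eq_neg_iff_add_eq_zero]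
  exact integral_mul_fderiv_eq_neg_fderiv_mul_of_integrable
    ((ha.dirDeriv _).integrable_mul (hb.dirDeriv _))
    (ha.integrable_mul ((hb.dirDeriv _).dirDeriv _)) (ha.integrable_mul (hb.dirDeriv _))
    (fun x _ => ha.differentiable x) (fun x _ => (hb.dirDeriv _).differentiable x)

/-- Integration by parts gives this for pairs coming from test functions; both sides are continuous
in the pair, so it survives the closure. -/
theorem inner_gradL2 (hb : IsTest Ω b) {y : LTwo Ω} {G : LTwoField Ω} (h : (y, G) ∈ HOneZero Ω) :
    inner ℝ G hb.gradL2 = -inner ℝ y hb.laplace.toL2 := by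
  have hc : IsClosed {p : LTwo Ω × LTwoField Ω |
      inner ℝ p.2 hb.gradL2 = -inner ℝ p.1 hb.laplace.toL2} :=
    isClosed_eq (by fun_prop) (by fun_prop)
  refine closure_minimal ?_ hc h
  rintro p ⟨φ, h1, h2⟩
  have hφ := φ.isTest
  have key := hφ.integral_inner_gradient hb
  simp only [mem_ofPred_eq]
  rw [L2.inner_def, L2.inner_def]
  rw [integral_congr_ae (g := fun x => inner ℝ (gradient (fun z => φ z) x) (gradient b x)) (by
      filter_upwards [h2, hb.coeFn_gradL2] with x h2 h3; rw [h2, h3]),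
    integral_congr_ae (f := fun x => inner ℝ (p.1 x) (hb.laplace.toL2 x))
      (g := fun x => φ x * _root_.laplace b x) (by
      filter_upwards [h1, hb.laplace.coeFn_toL2] with x h2 h3
      rw [h2, h3]; simp [mul_comm])]
  rw [setIntegral_eq_integral_of_forall_compl_eq_zero, setIntegral_eq_integral_of_forall_compl_eq_zero]
  · exact key
  · intro x hx; rw [hφ.eq_zero_of_notMem hx, zero_mul]
  · intro x hx
    rw [inner_gradient_left]
    rw [gradient_eq_sum_dirDeriv, map_sum]
    refine Finset.sum_eq_zero fun i _ => ?_
    rw [(hb.dirDeriv _).eq_zero_of_notMem hx, zero_smul, map_zero]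

end IsTest

/-! ### Test functions modulated by plane waves -/

theorem dirDeriv_add {a b : EuclideanSpace ℝ (Fin N) → ℝ} (ha : Differentiable ℝ a)
    (hb : Differentiable ℝ b) (f : EuclideanSpace ℝ (Fin N)) :
    dirDeriv f (fun x => a x + b x) = fun x => dirDeriv f a x + dirDeriv f b x := by
  ext x
  simp [dirDeriv, fderiv_fun_add (ha x) (hb x)]

theorem dirDeriv_const_mul {a : EuclideanSpace ℝ (Fin N) → ℝ} (ha : Differentiable ℝ a) (c : ℝ)
    (f : EuclideanSpace ℝ (Fin N)) :
    dirDeriv f (fun x => c * a x) = fun x => c * dirDeriv f a x := by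
  ext x
  simp [dirDeriv, fderiv_const_mul (ha x)]

/-- The plane wave `cos (n ⟨e, x⟩ + θ)`. -/
noncomputable def planeWave (e : EuclideanSpace ℝ (Fin N)) (n θ : ℝ) :
    EuclideanSpace ℝ (Fin N) → ℝ := fun x => Real.cos (n * inner ℝ e x + θ)

theorem contDiff_planeWave (e : EuclideanSpace ℝ (Fin N)) (n θ : ℝ) :
    ContDiff ℝ ((⊤ : ℕ∞) : WithTop ℕ∞) (planeWave e n θ) :=
  ((contDiff_const.mul (innerSL ℝ e).contDiff).add contDiff_const).cos

/-- Differentiating a cosine shifts its phase by a quarter period, so a free phase `θ` treats sine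
and cosine at once. -/
theorem dirDeriv_mul_planeWave {a : EuclideanSpace ℝ (Fin N) → ℝ} (ha : Differentiable ℝ a)
    (e f : EuclideanSpace ℝ (Fin N)) (n θ : ℝ) :
    dirDeriv f (fun x => a x * planeWave e n θ x) = fun x => dirDeriv f a x * planeWave e n θ x +
      (n * inner ℝ e f) * (a x * planeWave e n (θ + Real.pi / 2) x) := by
  ext x
  have h1 : HasFDerivAt (fun x => n * inner ℝ e x + θ) (n • innerSL ℝ e) x :=
    ((innerSL ℝ e).hasFDerivAt.const_mul n).add_const θ
  have h2 : HasFDerivAt (fun x => a x * planeWave e n θ x) _ x := (ha x).hasFDerivAt.mul h1.cos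
  rw [dirDeriv, h2.fderiv]
  have h3 : planeWave e n (θ + Real.pi / 2) x = -Real.sin (n * inner ℝ e x + θ) := by
    rw [planeWave, ← add_assoc, Real.cos_add_pi_div_two]
  rw [h3]
  simp [dirDeriv, planeWave]
  ring

theorem laplace_mul_planeWave {a : EuclideanSpace ℝ (Fin N) → ℝ} (ha : IsTest Ω a)
    {e : EuclideanSpace ℝ (Fin N)} (he : ‖e‖ = 1) (n θ : ℝ) (x : EuclideanSpace ℝ (Fin N)) :
    laplace (fun x => a x * planeWave e n θ x) x = laplace a x * planeWave e n θ x +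
      2 * n * (dirDeriv e a x * planeWave e n (θ + Real.pi / 2) x) -
      n ^ 2 * (a x * planeWave e n θ x) := by
  have h1 : planeWave e n (θ + Real.pi / 2 + Real.pi / 2) x = -planeWave e n θ x := by
    simp only [planeWave]
    rw [← Real.cos_add_pi]; ring_nf
  have h2 : ∀ f : EuclideanSpace ℝ (Fin N),
      dirDeriv f (dirDeriv f (fun x => a x * planeWave e n θ x)) x =
      dirDeriv f (dirDeriv f a) x * planeWave e n θ x +
      2 * n * planeWave e n (θ + Real.pi / 2) x * (inner ℝ f e * dirDeriv f a x) -
      n ^ 2 * (a x * planeWave e n θ x) * (inner ℝ e f * inner ℝ f e) := fun f => by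
    rw [dirDeriv_mul_planeWave ha.differentiable, dirDeriv_add, dirDeriv_const_mul,
      dirDeriv_mul_planeWave (ha.dirDeriv f).differentiable,
      dirDeriv_mul_planeWave ha.differentiable]
    · simp only [h1, real_inner_comm e f]
      ring
    · exact (ha.mul_right (contDiff_planeWave _ _ _)).differentiable
    · exact ((ha.dirDeriv f).mul_right (contDiff_planeWave _ _ _)).differentiable
    · exact ((ha.mul_right (contDiff_planeWave _ _ _)).const_mul _).differentiable
  have h3 : dirDeriv e a x = ∑ i, inner ℝ (EuclideanSpace.basisFun (Fin N) ℝ i) e *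
      dirDeriv (EuclideanSpace.basisFun (Fin N) ℝ i) a x := by
    conv_lhs => rw [← (EuclideanSpace.basisFun (Fin N) ℝ).sum_repr' e]
    simp only [dirDeriv, map_sum, map_smul, smul_eq_mul]
  simp_rw [laplace, h2]
  rw [Finset.sum_sub_distrib, Finset.sum_add_distrib, ← Finset.sum_mul, ← Finset.mul_sum,
    ← Finset.mul_sum, ← h3, OrthonormalBasis.sum_inner_mul_inner, real_inner_self_eq_norm_sq, he]
  ring

theorem planeWave_abs_le (e : EuclideanSpace ℝ (Fin N)) (n θ : ℝ) (x : EuclideanSpace ℝ (Fin N)) :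
    |planeWave e n θ x| ≤ 1 := Real.abs_cos_le_one _

namespace IsTest

variable {a : EuclideanSpace ℝ (Fin N) → ℝ}

theorem mul_planeWave (ha : IsTest Ω a) (e : EuclideanSpace ℝ (Fin N)) (n θ : ℝ) :
    IsTest Ω (fun x => a x * planeWave e n θ x) := ha.mul_right (contDiff_planeWave e n θ)

theorem norm_mul_planeWave_le (ha : IsTest Ω a) (e : EuclideanSpace ℝ (Fin N)) (n θ : ℝ) :
    ‖(ha.mul_planeWave e n θ).toL2‖ ≤ ‖ha.toL2‖ := by
  refine Lp.norm_le_norm_of_ae_le ?_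
  filter_upwards [(ha.mul_planeWave e n θ).coeFn_toL2, ha.coeFn_toL2] with x h1 h2
  rw [h1, h2, norm_mul]
  exact mul_le_of_le_one_right (norm_nonneg _) (planeWave_abs_le e n θ x)

/-- Adding `n²` cancels the leading term of the Laplacian; the residual is only of order `n`. -/
theorem laplace_mul_planeWave_toL2 (ha : IsTest Ω a) {e : EuclideanSpace ℝ (Fin N)} (he : ‖e‖ = 1)
    (n θ : ℝ) :
    (ha.mul_planeWave e n θ).laplace.toL2 + n ^ 2 • (ha.mul_planeWave e n θ).toL2 =
      (2 * n) • ((ha.dirDeriv e).mul_planeWave e n (θ + Real.pi / 2)).toL2 +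
      (ha.laplace.mul_planeWave e n θ).toL2 := by
  simp only [toL2, ← MemLp.toLp_const_smul, ← MemLp.toLp_add]
  congr 1
  ext x
  simp only [Pi.add_apply, Pi.smul_apply, smul_eq_mul, laplace_mul_planeWave ha he]
  ring

end IsTest

/-! ### The source term as a density in time -/

theorem sq_integral_mul_le {α : Type*} [MeasurableSpace α] {μ : Measure α} {f g : α → ℝ}
    (hf : MemLp f 2 μ) (hg : MemLp g 2 μ) :
    (∫ x, f x * g x ∂μ) ^ 2 ≤ (∫ x, f x ^ 2 ∂μ) * ∫ x, g x ^ 2 ∂μ := by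
  have key : ∀ {f g : α → ℝ} (hf : MemLp f 2 μ) (hg : MemLp g 2 μ),
      inner ℝ (hf.toLp f) (hg.toLp g) = ∫ x, f x * g x ∂μ := fun {f g} hf hg => by
    rw [L2.inner_def]
    refine integral_congr_ae ?_
    filter_upwards [hf.coeFn_toLp, hg.coeFn_toLp] with x h1 h2
    rw [h1, h2]; simp [mul_comm]
  have h := real_inner_mul_inner_self_le (hf.toLp f) (hg.toLp g)
  rw [key, key, key] at h
  simpa only [sq] using h

theorem norm_sq_eq_integral_sq {α : Type*} [MeasurableSpace α] {μ : Measure α} (f : Lp ℝ 2 μ) :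
    ‖f‖ ^ 2 = ∫ x, f x ^ 2 ∂μ := by
  rw [← real_inner_self_eq_norm_sq, L2.inner_def]
  simp [sq]

theorem restrict_spaceTimeCylinder (t : ℝ) : volume.restrict (spaceTimeCylinder Ω t) =
    (volume.restrict (Ω : Set (EuclideanSpace ℝ (Fin N)))).prod (volume.restrict (Ioo 0 t)) := by
  rw [spaceTimeCylinder, Measure.volume_eq_prod, Measure.prod_restrict]

/-- By Fubini the density is `β s = ∫ χ_ω u(x,s) v(x) dx`. Cauchy–Schwarz in `x`, then `‖u‖ ≤ 1`,
bounds it in `L²`. -/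
theorem exists_source_density {ω : Set (EuclideanSpace ℝ (Fin N))} (hω : IsOpen ω) {T : ℝ}
    {u : LTwoCylinder Ω T} (hu : ‖u‖ ≤ 1) (v : LTwo Ω) :
    ∃ β : ℝ → ℝ, MemLp β 2 (volume.restrict (Ioo 0 T)) ∧ ∫ s in Ioo 0 T, β s ^ 2 ≤ ‖v‖ ^ 2 ∧
      ∀ t ∈ Icc 0 T, ∫ p in spaceTimeCylinder Ω t,
        ω.indicator (fun _ => (1 : ℝ)) p.1 * u p * v p.1 = ∫ s in (0 : ℝ)..t, β s := by
  set μ := volume.restrict (Ω : Set (EuclideanSpace ℝ (Fin N))) with hμ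
  set ν := volume.restrict (Ioo 0 T) with hν
  have hu2 : MemLp u 2 (μ.prod ν) := by
    rw [← restrict_spaceTimeCylinder]; exact Lp.memLp u
  set g : EuclideanSpace ℝ (Fin N) → ℝ := fun x => ω.indicator (fun _ => (1 : ℝ)) x * v x with hg
  have hgv : ∀ x, ‖g x‖ ≤ ‖v x‖ := fun x => by
    simp only [hg, indicator]; split_ifs <;> simp
  have hg2 : MemLp g 2 μ := (Lp.memLp v).mono
    ((aestronglyMeasurable_const.indicator hω.measurableSet).mul (Lp.aestronglyMeasurable v))
    (ae_of_all _ hgv)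
  have hgprod : MemLp (fun p : EuclideanSpace ℝ (Fin N) × ℝ => g p.1) 2 (μ.prod ν) :=
    hg2.comp_fst ν
  have hui : Integrable (fun p : EuclideanSpace ℝ (Fin N) × ℝ => u p * g p.1) (μ.prod ν) :=
    hu2.integrable_mul hgprod
  have husq : Integrable (fun p => u p ^ 2) (μ.prod ν) := hu2.integrable_sq
  set β : ℝ → ℝ := fun s => ∫ x, u (x, s) * g x ∂μ with hβ
  have hβi : Integrable β ν := hui.integral_prod_right
  have hβle : ∀ᵐ s ∂ν, β s ^ 2 ≤ ‖v‖ ^ 2 * ∫ x, u (x, s) ^ 2 ∂μ := by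
    filter_upwards [husq.prod_left_ae, hu2.aestronglyMeasurable.prodMk_right] with s h1 h2
    have h3 : MemLp (fun x => u (x, s)) 2 μ := (memLp_two_iff_integrable_sq h2).2 h1
    refine (sq_integral_mul_le h3 hg2).trans ?_
    rw [mul_comm]
    refine mul_le_mul_of_nonneg_right ?_ (integral_nonneg fun _ => sq_nonneg _)
    rw [norm_sq_eq_integral_sq]
    refine integral_mono hg2.integrable_sq (Lp.memLp v).integrable_sq fun x => ?_
    exact sq_le_sq.2 (hgv x)
  have hbd : Integrable (fun s => ‖v‖ ^ 2 * ∫ x, u (x, s) ^ 2 ∂μ) ν :=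
    husq.integral_prod_right.const_mul _
  have hβ2 : Integrable (fun s => β s ^ 2) ν := by
    refine hbd.mono' (hβi.aestronglyMeasurable.pow 2) (hβle.mono fun s hs => ?_)
    rwa [Real.norm_of_nonneg (sq_nonneg _)]
  refine ⟨β, (memLp_two_iff_integrable_sq hβi.aestronglyMeasurable).2 hβ2, ?_, ?_⟩
  · refine (integral_mono_ae hβ2 hbd hβle).trans ?_
    rw [integral_const_mul, ← integral_prod_symm _ husq]
    refine mul_le_of_le_one_right (sq_nonneg _) ?_
    have hprod : volume.restrict (spaceTimeCylinder Ω T) = μ.prod ν := restrict_spaceTimeCylinder T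
    rw [← hprod, ← norm_sq_eq_integral_sq u]
    exact pow_le_one₀ (norm_nonneg _) hu
  · intro t ht
    have hui' : Integrable (fun p : EuclideanSpace ℝ (Fin N) × ℝ => u p * g p.1)
        (μ.prod (volume.restrict (Ioo 0 t))) := by
      rw [← restrict_spaceTimeCylinder] at hui ⊢
      exact hui.mono_measure (Measure.restrict_mono
        (prod_mono_right (Ioo_subset_Ioo_right ht.2)) le_rfl)
    rw [restrict_spaceTimeCylinder, intervalIntegral.integral_of_le ht.1,
      integral_Ioc_eq_integral_Ioo, hβ, ← integral_prod_symm _ hui']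
    congr 1
    ext p
    simp only [hg]
    ring

theorem sq_intervalIntegral_le {T : ℝ} {β : ℝ → ℝ} (hβ : MemLp β 2 (volume.restrict (Ioo 0 T)))
    {t : ℝ} (ht : t ∈ Icc 0 T) :
    (∫ s in (0 : ℝ)..t, β s) ^ 2 ≤ T * ∫ s in Ioo 0 T, β s ^ 2 := by
  have hle : volume.restrict (Ioo 0 t) ≤ volume.restrict (Ioo 0 T) :=
    Measure.restrict_mono (Ioo_subset_Ioo_right ht.2) le_rfl
  have h := sq_integral_mul_le (hβ.mono_measure hle) (memLp_const (1 : ℝ))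
  simp only [mul_one, one_pow, integral_const, smul_eq_mul, MeasurableSet.univ,
    measureReal_restrict_apply, univ_inter, Real.volume_real_Ioo_of_le ht.1, sub_zero] at h
  rw [intervalIntegral.integral_of_le ht.1, integral_Ioc_eq_integral_Ioo]
  refine h.trans ?_
  rw [mul_comm]
  refine mul_le_mul ht.2 ?_ (integral_nonneg fun _ => sq_nonneg _) (ht.1.trans ht.2)
  exact integral_mono_measure hle (ae_of_all _ fun _ => sq_nonneg _) hβ.integrable_sq

/-! ### Energy estimates -/

namespace IsHeatSolution

variable {ω : Set (EuclideanSpace ℝ (Fin N))} {T : ℝ} {u : LTwoCylinder Ω T} {y : ℝ → LTwo Ω}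

theorem integrable_of_continuousOn {f : ℝ → ℝ} (hf : ContinuousOn f (Icc 0 T)) :
    Integrable f (volume.restrict (Ioo 0 T)) :=
  (hf.integrableOn_compact isCompact_Icc).mono_set Ioo_subset_Icc_self

/-- The equation integrated up to time `t` is tested with `y t` itself. Integrated once more in `t`,
the gradient term becomes `‖∫ G‖²/2 ≥ 0` and can be dropped; no time derivative of `y` is needed. -/
theorem integral_norm_sq_le (hω : IsOpen ω) (hT : 0 < T) (hu : ‖u‖ ≤ 1)
    (hy : IsHeatSolution Ω ω T u 0 y) : ∫ t in Ioo 0 T, ‖y t‖ ^ 2 ≤ T ^ 2 := by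
  obtain ⟨G, hG2, hH, hw⟩ := hy.weak
  have hG : Integrable G (volume.restrict (Ioo 0 T)) := hG2.integrable (by norm_num)
  obtain ⟨hPi, hP⟩ := integral_integral_inner_primitive hG
  have hyi : Integrable (fun t => ‖y t‖ ^ 2) (volume.restrict (Ioo 0 T)) :=
    integrable_of_continuousOn (hy.continuousOn.norm.pow 2)
  have hae : ∀ᵐ t ∂(volume.restrict (Ioo 0 T)),
      ‖y t‖ ^ 2 ≤ T - 2 * ∫ s in (0 : ℝ)..t, inner ℝ (G s) (G t) := by
    filter_upwards [hH, ae_restrict_mem measurableSet_Ioo] with t ht htT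
    have htc := Ioo_subset_Icc_self htT
    have h1 := hw (y t) (G t) ht t htc
    obtain ⟨β, hβ, hβ1, hβ2⟩ := exists_source_density hω hu (y t)
    rw [hβ2 t htc, real_inner_self_eq_norm_sq, inner_zero_left, sub_zero] at h1
    have h2 := sq_intervalIntegral_le hβ htc
    have h3 : (∫ s in (0 : ℝ)..t, β s) ^ 2 ≤ T * ‖y t‖ ^ 2 :=
      h2.trans (mul_le_mul_of_nonneg_left hβ1 hT.le)
    -- AM–GM; the half of `‖y t‖²` is absorbed on the left.
    have h4 : (∫ s in (0 : ℝ)..t, β s) ≤ T / 2 + ‖y t‖ ^ 2 / 2 := by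
      refine (abs_le_of_sq_le_sq' ?_ (by positivity)).2
      nlinarith [sq_nonneg (T - ‖y t‖ ^ 2)]
    linarith
  have h := integral_mono_ae hyi ((integrable_const T).sub (hPi.const_mul 2)) hae
  simp only [Pi.sub_apply] at h
  rw [integral_sub (integrable_const T) (hPi.const_mul 2), integral_const_mul, hP] at h
  simp only [integral_const, smul_eq_mul, MeasurableSet.univ, measureReal_restrict_apply,
    univ_inter, Real.volume_real_Ioo_of_le hT.le, sub_zero] at h
  nlinarith [sq_nonneg ‖∫ t in Ioo 0 T, G t‖]

/-- With `h = ⟨y, b⟩`, the equation says that `h` is the primitive of `k = β + r - c h`. Integrating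
`h k` gives `h(T)²/2`, and the damping `-c h²` absorbs the cross terms. -/
theorem sq_inner_add_integral_le (hω : IsOpen ω) (hT : 0 < T) (hu : ‖u‖ ≤ 1)
    (hy : IsHeatSolution Ω ω T u 0 y) {b : EuclideanSpace ℝ (Fin N) → ℝ} (hb : IsTest Ω b)
    {c : ℝ} (hc : 0 < c) :
    inner ℝ (y T) hb.toL2 ^ 2 + c * ∫ t in Ioo 0 T, inner ℝ (y t) hb.toL2 ^ 2 ≤
      2 / c * (‖hb.toL2‖ ^ 2 +
        ∫ t in Ioo 0 T, inner ℝ (y t) (hb.laplace.toL2 + c • hb.toL2) ^ 2) := by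
  obtain ⟨G, hG2, hH, hw⟩ := hy.weak
  have hG : Integrable G (volume.restrict (Ioo 0 T)) := hG2.integrable (by norm_num)
  obtain ⟨β, hβ, hβ1, hβ2⟩ := exists_source_density hω hu hb.toL2
  have hβi : Integrable β (volume.restrict (Ioo 0 T)) := hβ.integrable (by norm_num)
  have hgi : Integrable (fun s => inner ℝ (G s) hb.gradL2) (volume.restrict (Ioo 0 T)) :=
    hG.inner_const _
  set k : ℝ → ℝ := fun s => β s - inner ℝ (G s) hb.gradL2 with hk
  set h : ℝ → ℝ := fun t => inner ℝ (y t) hb.toL2 with hh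
  set r : ℝ → ℝ := fun t => inner ℝ (y t) (hb.laplace.toL2 + c • hb.toL2) with hr
  have hki : Integrable k (volume.restrict (Ioo 0 T)) := hβi.sub hgi
  have hii : ∀ {f : ℝ → ℝ}, Integrable f (volume.restrict (Ioo 0 T)) → ∀ t ∈ Icc 0 T,
      IntervalIntegrable f volume 0 t := fun {f} hf t ht => by
    rw [intervalIntegrable_iff_integrableOn_Ioo_of_le ht.1]
    exact IntegrableOn.mono_set hf (Ioo_subset_Ioo_right ht.2)
  have hhk : ∀ t ∈ Icc 0 T, h t = ∫ s in (0 : ℝ)..t, k s := fun t ht => by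
    have := hw _ _ hb.mem_HOneZero t ht
    rw [hβ2 t ht, inner_zero_left, sub_zero] at this
    rw [intervalIntegral.integral_sub (hii hβi t ht) (hii hgi t ht), ← this]
    simp [hh]
  have hhc : ContinuousOn h (Icc 0 T) := hy.continuousOn.inner continuousOn_const
  have hrc : ContinuousOn r (Icc 0 T) := hy.continuousOn.inner continuousOn_const
  have hh2 : Integrable (fun t => h t ^ 2) (volume.restrict (Ioo 0 T)) :=
    integrable_of_continuousOn (hhc.pow 2)
  have hr2 : Integrable (fun t => r t ^ 2) (volume.restrict (Ioo 0 T)) :=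
    integrable_of_continuousOn (hrc.pow 2)
  have hhT : h T = ∫ t in Ioo 0 T, k t := by
    rw [hhk T (right_mem_Icc.2 hT.le), intervalIntegral.integral_of_le hT.le,
      integral_Ioc_eq_integral_Ioo]
  have e1 : ∫ t in Ioo 0 T, h t * k t = h T ^ 2 / 2 := by
    rw [hhT, ← integral_primitive_mul hki]
    refine setIntegral_congr_fun measurableSet_Ioo fun t ht => ?_
    simp only [hhk t (Ioo_subset_Icc_self ht)]
  have e2 : ∀ᵐ t ∂(volume.restrict (Ioo 0 T)),
      h t * k t ≤ (β t ^ 2 + r t ^ 2) / c - c / 2 * h t ^ 2 := by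
    filter_upwards [hH] with t ht
    have h1 : k t = β t + r t - c * h t := by
      simp only [hk, hr, hh, hb.inner_gradL2 ht, inner_add_right, inner_smul_right]
      ring
    -- Young's inequality on `h β` and `h r` spends `c/4 h²` each, leaving half of the damping.
    have h2 : (β t ^ 2 + r t ^ 2) / c - c / 2 * h t ^ 2 - h t * k t =
        ((β t - c / 2 * h t) ^ 2 + (r t - c / 2 * h t) ^ 2) / c := by
      rw [h1]; field_simp; ring
    have h3 : 0 ≤ ((β t - c / 2 * h t) ^ 2 + (r t - c / 2 * h t) ^ 2) / c := by positivity
    linarith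
  have hbdi : Integrable (fun t => (β t ^ 2 + r t ^ 2) / c - c / 2 * h t ^ 2)
      (volume.restrict (Ioo 0 T)) :=
    ((hβ.integrable_sq.add hr2).div_const c).sub (hh2.const_mul _)
  have hhki : Integrable (fun t => h t * k t) (volume.restrict (Ioo 0 T)) := by
    obtain ⟨C, hC⟩ := isCompact_Icc.exists_bound_of_continuousOn hhc
    refine hki.bdd_mul (c := C)
      ((hhc.mono Ioo_subset_Icc_self).aestronglyMeasurable measurableSet_Ioo) ?_
    filter_upwards [ae_restrict_mem measurableSet_Ioo] with t ht
    exact hC t (Ioo_subset_Icc_self ht)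
  have e3 := integral_mono_ae hhki hbdi e2
  have hsum : Integrable (fun t => (β t ^ 2 + r t ^ 2) / c) (volume.restrict (Ioo 0 T)) :=
    (hβ.integrable_sq.add hr2).div_const c
  rw [e1, integral_sub hsum (hh2.const_mul _),
    integral_div, integral_add hβ.integrable_sq hr2, integral_const_mul] at e3
  have e4 : (∫ t in Ioo 0 T, β t ^ 2) / c ≤ ‖hb.toL2‖ ^ 2 / c :=
    div_le_div_of_nonneg_right hβ1 hc.le
  rw [add_div] at e3
  have e5 : 2 / c * (‖hb.toL2‖ ^ 2 + ∫ t in Ioo 0 T, r t ^ 2) =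
    2 * (‖hb.toL2‖ ^ 2 / c + (∫ t in Ioo 0 T, r t ^ 2) / c) := by ring
  rw [e5]
  linarith

end IsHeatSolution

/-! ### Finite codimensionality and weakly null sequences -/

/-- Pairing with `v` maps the closed convex hull into an interval of length `2ε`. Both `s₀ + k` and
`s₀ - k` lie in the hull, so `⟨v, k⟩ ≤ ε`; then `k` is taken along the projection of `v`. -/
theorem norm_starProjection_le_of_ball_subset {Y : Type*} [NormedAddCommGroup Y]
    [InnerProductSpace ℝ Y] {M : Set Y} {x₀ : Y} (K : Submodule ℝ Y) [K.HasOrthogonalProjection]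
    {s₀ : Y} {r : ℝ} (hr : 0 < r)
    (hK : ∀ k ∈ K, ‖k‖ < r → s₀ + k ∈ closedConvexHull ℝ (M - ({x₀} : Set Y))) {v : Y} {ε : ℝ}
    (hv : ∀ m ∈ M, |inner ℝ m v| ≤ ε) : ‖K.starProjection v‖ ≤ 2 / r * ε := by
  have hsub : closedConvexHull ℝ (M - ({x₀} : Set Y)) ⊆
      innerSL ℝ v ⁻¹' Icc (-ε - inner ℝ v x₀) (ε - inner ℝ v x₀) := by
    refine closedConvexHull_min ?_ ((convex_Icc _ _).linear_preimage (innerSL ℝ v).toLinearMap)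
      (isClosed_Icc.preimage (innerSL ℝ v).continuous)
    rintro _ ⟨m, hm, _, rfl, rfl⟩
    have := abs_le.1 (hv m hm)
    rw [real_inner_comm] at this
    simp only [mem_preimage, innerSL_apply_apply, inner_sub_right, mem_Icc]
    constructor <;> linarith
  have hk : ∀ k ∈ K, ‖k‖ < r → inner ℝ v k ≤ ε := fun k hk hkr => by
    have h1 := hsub (hK k hk hkr)
    have h2 := hsub (hK (-k) (K.neg_mem hk) (by rwa [norm_neg]))
    simp only [mem_preimage, innerSL_apply_apply, inner_add_right, inner_neg_right, mem_Icc]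
      at h1 h2
    linarith
  set p := K.starProjection v with hp
  have hpK : p ∈ K := K.starProjection_apply_mem v
  have hpp : inner ℝ v p = ‖p‖ ^ 2 := by
    rw [← real_inner_self_eq_norm_sq, ← sub_eq_zero, ← inner_sub_left]
    exact Submodule.inner_left_of_mem_orthogonal hpK (K.sub_starProjection_mem_orthogonal v)
  rcases eq_or_ne p 0 with h0 | h0
  · have := hk 0 K.zero_mem (by simpa using hr)
    rw [inner_zero_right] at this
    rw [h0, norm_zero]; positivity
  have hn : 0 < ‖p‖ := norm_pos_iff.2 h0
  -- The scaling gives norm `r/2`, inside the open ball.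
  have := hk ((r / (2 * ‖p‖)) • p) (K.smul_mem _ hpK) (by
    rw [norm_smul, Real.norm_of_nonneg (by positivity)]
    field_simp; linarith)
  rw [inner_smul_right, hpp] at this
  have h2 : r / (2 * ‖p‖) * ‖p‖ ^ 2 = r / 2 * ‖p‖ := by field_simp
  rw [h2] at this
  rw [div_mul_eq_mul_div, le_div_iff₀ hr]
  linarith

theorem tendsto_norm_starProjection_of_weakly_null {Y : Type*} [NormedAddCommGroup Y]
    [InnerProductSpace ℝ Y] (F : Submodule ℝ Y) [FiniteDimensional ℝ F] {v : ℕ → Y}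
    (hv : ∀ z, Tendsto (fun n => inner ℝ z (v n)) atTop (𝓝 0)) :
    Tendsto (fun n => ‖F.starProjection (v n)‖ ^ 2) atTop (𝓝 0) := by
  have h : ∀ n, ‖F.starProjection (v n)‖ ^ 2 =
      ∑ i, inner ℝ ((stdOrthonormalBasis ℝ F i : F) : Y) (v n) ^ 2 := fun n => by
    rw [Submodule.starProjection_apply, ← Submodule.coe_norm,
      ← (stdOrthonormalBasis ℝ F).sum_sq_norm_inner_right]
    refine Finset.sum_congr rfl fun i _ => ?_
    rw [Real.norm_eq_abs, sq_abs, Submodule.inner_orthogonalProjectionOnto_eq_of_mem_left]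
  simp_rw [h]
  simpa using tendsto_finsetSum (Finset.univ) fun i _ =>
    (hv ((stdOrthonormalBasis ℝ F i : F) : Y)).pow 2

theorem IsFiniteCodimensional.tendsto_norm_sq {Y : Type*} [NormedAddCommGroup Y]
    [InnerProductSpace ℝ Y] [CompleteSpace Y] {M : Set Y} (hM : IsFiniteCodimensional M)
    {v : ℕ → Y} (hv : ∀ z, Tendsto (fun n => inner ℝ z (v n)) atTop (𝓝 0)) {ε : ℕ → ℝ}
    (hε : Tendsto ε atTop (𝓝 0)) (hvε : ∀ᶠ n in atTop, ∀ m ∈ M, |inner ℝ m (v n)| ≤ ε n) :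
    Tendsto (fun n => ‖v n‖ ^ 2) atTop (𝓝 0) := by
  obtain ⟨x₀, -, hfin, hint⟩ := hM
  set K := closedSpan (M - ({x₀} : Set Y))
  obtain ⟨s₀, hs₀⟩ := hint
  have hKc : IsClosed (K : Set Y) := Submodule.isClosed_topologicalClosure _
  have : CompleteSpace K := hKc.completeSpace_coe
  have : FiniteDimensional ℝ Kᗮ :=
    (Submodule.quotientEquivOfIsCompl K Kᗮ K.isCompl_orthogonal).finiteDimensional
  obtain ⟨r, hr, hball⟩ := Metric.mem_nhds_iff.1 (mem_interior_iff_mem_nhds.1 hs₀)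
  have hK : ∀ k ∈ K, ‖k‖ < r → (s₀ : Y) + k ∈ closedConvexHull ℝ (M - ({x₀} : Set Y)) :=
    fun k hk hkr => by
      have hmem : s₀ + ⟨k, hk⟩ ∈ Metric.ball s₀ r := by
        rwa [mem_ball_iff_norm, add_sub_cancel_left]
      exact hball hmem
  have h1 : Tendsto (fun n => ‖K.starProjection (v n)‖ ^ 2) atTop (𝓝 0) := by
    have h2 : Tendsto (fun n => ‖K.starProjection (v n)‖) atTop (𝓝 0) := by
      refine squeeze_zero' (Eventually.of_forall fun _ => norm_nonneg _)
        (hvε.mono fun n hn => norm_starProjection_le_of_ball_subset K hr hK hn) ?_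
      simpa using hε.const_mul (2 / r)
    simpa using h2.pow 2
  have h3 := h1.add (tendsto_norm_starProjection_of_weakly_null Kᗮ hv)
  rw [add_zero] at h3
  refine h3.congr fun n => ?_
  exact (K.norm_sq_eq_add_norm_sq_starProjection (v n)).symm

/-! ### Weak limit and norms of the modulated waves -/

namespace IsTest

variable {a : EuclideanSpace ℝ (Fin N) → ℝ}

theorem tendsto_inner_mul_planeWave (ha : IsTest Ω a) {e : EuclideanSpace ℝ (Fin N)}
    (he : ‖e‖ = 1) (θ : ℝ) (z : LTwo Ω) :
    Tendsto (fun n : ℕ => inner ℝ z (ha.mul_planeWave e n θ).toL2) atTop (𝓝 0) := by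
  set f : EuclideanSpace ℝ (Fin N) → ℂ := (Ω : Set (EuclideanSpace ℝ (Fin N))).indicator
    fun x => Complex.exp (θ * Complex.I) * ((z x * a x : ℝ) : ℂ) with hf
  have hzi : Integrable (fun x => z x * a x)
      (volume.restrict (Ω : Set (EuclideanSpace ℝ (Fin N)))) := (Lp.memLp z).integrable_mul ha.memLp
  have hfi : Integrable f := by
    rw [hf, integrable_indicator_iff Ω.isOpen.measurableSet]
    exact hzi.ofReal.const_mul _
  -- The Fourier kernel is `exp(-2πi⟨x,w⟩)`, so `w = -(n/2π) e` produces `exp(in⟨e,x⟩)`; the phase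
  -- `θ` sits in `f` as a constant factor.
  have hw : Tendsto (fun n : ℕ => (-(n / (2 * Real.pi)) : ℝ) • e) atTop
      (cocompact (EuclideanSpace ℝ (Fin N))) := by
    rw [← Metric.cobounded_eq_cocompact, ← tendsto_norm_atTop_iff_cobounded]
    have : ∀ n : ℕ, ‖(-(n / (2 * Real.pi)) : ℝ) • e‖ = n / (2 * Real.pi) := fun n => by
      rw [norm_smul, he, mul_one, norm_neg, Real.norm_of_nonneg (by positivity)]
    simp_rw [this]
    exact tendsto_natCast_atTop_atTop.atTop_div_const (by positivity)
  have h1 := (Complex.continuous_re.tendsto _).comp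
    ((tendsto_integral_exp_inner_smul_cocompact f).comp hw)
  rw [Complex.zero_re] at h1
  refine h1.congr fun n => ?_
  have hint : Integrable (fun x => Real.fourierChar (-inner ℝ x ((-(n / (2 * Real.pi)) : ℝ) • e)) •
      f x) := (Real.fourierIntegral_convergent_iff (f := f) (μ := volume) _).2 hfi
  simp only [Function.comp_apply]
  rw [← RCLike.re_eq_complex_re, ← integral_re hint, L2.inner_def,
    ← integral_indicator Ω.isOpen.measurableSet]
  refine integral_congr_ae ?_
  have h2 := (ha.mul_planeWave e n θ).coeFn_toL2
  rw [Filter.EventuallyEq, ae_restrict_iff' Ω.isOpen.measurableSet] at h2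
  filter_upwards [h2] with x hx
  by_cases hxΩ : x ∈ (Ω : Set (EuclideanSpace ℝ (Fin N)))
  · rw [hf, indicator_of_mem hxΩ, indicator_of_mem hxΩ, hx hxΩ, Circle.smul_def,
      Real.fourierChar_apply, smul_eq_mul, ← mul_assoc, ← Complex.exp_add]
    have : ((2 * Real.pi * -inner ℝ x ((-(n / (2 * Real.pi)) : ℝ) • e) : ℝ) : ℂ) * Complex.I +
        θ * Complex.I = ((n * inner ℝ e x + θ : ℝ) : ℂ) * Complex.I := by
      rw [inner_smul_right, real_inner_comm]
      have hpi := Real.pi_ne_zero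
      rw [← add_mul]
      norm_cast
      congr 2
      field_simp
    rw [this, RCLike.re_eq_complex_re, Complex.re_mul_ofReal, Complex.exp_ofReal_mul_I_re]
    simp only [planeWave, RCLike.inner_apply, conj_trivial]
    ring
  · rw [hf, indicator_of_notMem hxΩ, indicator_of_notMem hxΩ]; simp

theorem norm_sq_mul_planeWave_add (ha : IsTest Ω a) (e : EuclideanSpace ℝ (Fin N)) (n : ℝ) :
    ‖(ha.mul_planeWave e n 0).toL2‖ ^ 2 + ‖(ha.mul_planeWave e n (-(Real.pi / 2))).toL2‖ ^ 2 =
      ‖ha.toL2‖ ^ 2 := by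
  rw [norm_sq_eq_integral_sq, norm_sq_eq_integral_sq, norm_sq_eq_integral_sq,
    ← integral_add (Lp.memLp _).integrable_sq (Lp.memLp _).integrable_sq]
  refine integral_congr_ae ?_
  filter_upwards [ha.coeFn_toL2, (ha.mul_planeWave e n 0).coeFn_toL2,
    (ha.mul_planeWave e n (-(Real.pi / 2))).coeFn_toL2] with x h1 h2 h3
  rw [h1, h2, h3]
  simp only [planeWave, ← sub_eq_add_neg, Real.cos_sub_pi_div_two, add_zero]
  linear_combination a x ^ 2 * Real.cos_sq_add_sin_sq (n * inner ℝ e x)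

end IsTest

theorem exists_isTest_ne_zero (hΩ : (Ω : Set (EuclideanSpace ℝ (Fin N))).Nonempty) :
    ∃ (a : EuclideanSpace ℝ (Fin N) → ℝ) (ha : IsTest Ω a), ha.toL2 ≠ 0 := by
  obtain ⟨x, hx⟩ := hΩ
  obtain ⟨a, h1, h2, h3, -, h5⟩ :=
    exists_contDiff_tsupport_subset (n := ⊤) (Ω.isOpen.mem_nhds hx)
  have ha : IsTest Ω a := ⟨h3, h2, h1⟩
  refine ⟨a, ha, fun h0 => ?_⟩
  have h6 : a =ᵐ[volume.restrict (Ω : Set (EuclideanSpace ℝ (Fin N)))] 0 :=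
    ha.coeFn_toL2.symm.trans (by rw [h0]; exact Lp.coeFn_zero _ _ _)
  rw [Filter.EventuallyEq, ae_restrict_iff' Ω.isOpen.measurableSet] at h6
  have h7 : a =ᵐ[volume] 0 := by
    filter_upwards [h6] with x hx
    by_cases hxΩ : x ∈ (Ω : Set (EuclideanSpace ℝ (Fin N)))
    · exact hx hxΩ
    · exact ha.eq_zero_of_notMem hxΩ
  have h8 := (ha.continuous.ae_eq_iff_eq volume continuous_zero).1 h7
  rw [h8] at h5
  simp at h5

/-! ### Decay of the pairings with reachable states -/

namespace IsHeatSolution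

variable {ω : Set (EuclideanSpace ℝ (Fin N))} {T : ℝ}
  {a : EuclideanSpace ℝ (Fin N) → ℝ} {e : EuclideanSpace ℝ (Fin N)}

/-- First pass, with `c = n²`: the residual is `O(n)` in norm and `y` is bounded in `L²` over time,
which suffices for the time integral. -/
theorem exists_integral_sq_inner_planeWave_le (hω : IsOpen ω) (hT : 0 < T) (ha : IsTest Ω a)
    (he : ‖e‖ = 1) : ∃ C : ℝ, ∀ (u : LTwoCylinder Ω T) (y : ℝ → LTwo Ω), ‖u‖ ≤ 1 →
      IsHeatSolution Ω ω T u 0 y → ∀ n : ℝ, 1 ≤ n → ∀ θ,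
      n ^ 2 * ∫ t in Ioo 0 T, inner ℝ (y t) (ha.mul_planeWave e n θ).toL2 ^ 2 ≤ C := by
  set K := 2 * ‖(ha.dirDeriv e).toL2‖ + ‖ha.laplace.toL2‖ with hK
  refine ⟨2 * (‖ha.toL2‖ ^ 2 + T ^ 2 * K ^ 2), fun u y hu hy n hn θ => ?_⟩
  have hn0 : 0 < n := by linarith
  have hb := ha.mul_planeWave e n θ
  have h1 := hy.sq_inner_add_integral_le hω hT hu hb (c := n ^ 2) (by positivity)
  set w := hb.laplace.toL2 + n ^ 2 • hb.toL2 with hw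
  have hwn : ‖w‖ ≤ n * K := by
    rw [hw, ha.laplace_mul_planeWave_toL2 he]
    refine (norm_add_le _ _).trans ?_
    rw [norm_smul, Real.norm_of_nonneg (by positivity)]
    have e1 := (ha.dirDeriv e).norm_mul_planeWave_le e n (θ + Real.pi / 2)
    have e2 := ha.laplace.norm_mul_planeWave_le e n θ
    have e3 : ‖ha.laplace.toL2‖ ≤ n * ‖ha.laplace.toL2‖ :=
      le_mul_of_one_le_left (norm_nonneg _) hn
    have e4 := mul_le_mul_of_nonneg_left e1 (by positivity : 0 ≤ 2 * n)
    rw [hK]; linarith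
  have h2 : ∫ t in Ioo 0 T, inner ℝ (y t) w ^ 2 ≤ T ^ 2 * (n * K) ^ 2 := by
    have : ∫ t in Ioo 0 T, inner ℝ (y t) w ^ 2 ≤ ∫ t in Ioo 0 T, ‖y t‖ ^ 2 * (n * K) ^ 2 := by
      refine integral_mono
        (integrable_of_continuousOn ((hy.continuousOn.inner continuousOn_const).pow 2))
        ((integrable_of_continuousOn (hy.continuousOn.norm.pow 2)).mul_const _) fun t => ?_
      simp only
      rw [← mul_pow, ← sq_abs]
      gcongr
      exact (abs_real_inner_le_norm _ _).trans (by gcongr)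
    rw [integral_mul_const] at this
    exact this.trans (mul_le_mul_of_nonneg_right (hy.integral_norm_sq_le hω hT hu) (sq_nonneg _))
  have h3 : ‖hb.toL2‖ ^ 2 ≤ n ^ 2 * ‖ha.toL2‖ ^ 2 := by
    rw [← mul_pow]
    gcongr
    exact (ha.norm_mul_planeWave_le e n θ).trans (le_mul_of_one_le_left (norm_nonneg _) hn)
  have h4 : 2 / n ^ 2 * (‖hb.toL2‖ ^ 2 + ∫ t in Ioo 0 T, inner ℝ (y t) w ^ 2) ≤
      2 / n ^ 2 * (n ^ 2 * ‖ha.toL2‖ ^ 2 + T ^ 2 * (n * K) ^ 2) := by gcongr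
  have h5 : 2 / n ^ 2 * (n ^ 2 * ‖ha.toL2‖ ^ 2 + T ^ 2 * (n * K) ^ 2) =
      2 * (‖ha.toL2‖ ^ 2 + T ^ 2 * K ^ 2) := by field_simp
  have h6 := sq_nonneg (inner ℝ (y T) hb.toL2)
  linarith

/-- Second pass: the first one, applied to the amplitude `∂ₑa`, compensates the factor `2n` in the
residual. The squared residual pairing then has a bounded time integral, and `2/c = 2/n²` gives the
decay at time `T`. -/
theorem exists_sq_inner_planeWave_le (hω : IsOpen ω) (hT : 0 < T) (ha : IsTest Ω a)
    (he : ‖e‖ = 1) : ∃ C : ℝ, ∀ z ∈ heatReachableUnitBall Ω ω T, ∀ n : ℝ, 1 ≤ n → ∀ θ,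
      inner ℝ z (ha.mul_planeWave e n θ).toL2 ^ 2 ≤ C / n ^ 2 := by
  obtain ⟨C, hC⟩ := exists_integral_sq_inner_planeWave_le hω hT (ha.dirDeriv e) he
  refine ⟨2 * (‖ha.toL2‖ ^ 2 + (8 * C + 2 * T ^ 2 * ‖ha.laplace.toL2‖ ^ 2)), ?_⟩
  rintro _ ⟨u, hu, y, hy, rfl⟩ n hn θ
  have hn0 : 0 < n := by linarith
  have hb := ha.mul_planeWave e n θ
  have h1 := hy.sq_inner_add_integral_le hω hT hu hb (c := n ^ 2) (by positivity)
  rw [ha.laplace_mul_planeWave_toL2 he] at h1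
  set v := ((ha.dirDeriv e).mul_planeWave e n (θ + Real.pi / 2)).toL2 with hv
  set q := (ha.laplace.mul_planeWave e n θ).toL2 with hq
  have hqn : ‖q‖ ≤ ‖ha.laplace.toL2‖ := ha.laplace.norm_mul_planeWave_le e n θ
  have hCn := hC u y hu hy n hn (θ + Real.pi / 2)
  have hvi : Integrable (fun t => inner ℝ (y t) v ^ 2) (volume.restrict (Ioo 0 T)) :=
    integrable_of_continuousOn ((hy.continuousOn.inner continuousOn_const).pow 2)
  have hyi : Integrable (fun t => ‖y t‖ ^ 2) (volume.restrict (Ioo 0 T)) :=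
    integrable_of_continuousOn (hy.continuousOn.norm.pow 2)
  have h2 : ∫ t in Ioo 0 T, inner ℝ (y t) ((2 * n) • v + q) ^ 2 ≤
      8 * C + 2 * T ^ 2 * ‖ha.laplace.toL2‖ ^ 2 := by
    -- From `(2nα + q)² ≤ 8n²α² + 2q²`; the `8C` comes from `n² ∫ α² ≤ C`.
    have h3 : ∫ t in Ioo 0 T, inner ℝ (y t) ((2 * n) • v + q) ^ 2 ≤
        ∫ t in Ioo 0 T, (8 * n ^ 2 * inner ℝ (y t) v ^ 2 +
          2 * ‖ha.laplace.toL2‖ ^ 2 * ‖y t‖ ^ 2) := by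
      refine integral_mono
        (integrable_of_continuousOn ((hy.continuousOn.inner continuousOn_const).pow 2))
        ((hvi.const_mul _).add (hyi.const_mul _)) fun t => ?_
      have h4 : inner ℝ (y t) q ^ 2 ≤ ‖ha.laplace.toL2‖ ^ 2 * ‖y t‖ ^ 2 := by
        rw [← mul_pow, ← sq_abs, mul_comm]
        gcongr
        exact (abs_real_inner_le_norm _ _).trans (by gcongr)
      simp only [inner_add_right, inner_smul_right]
      nlinarith [sq_nonneg (2 * n * inner ℝ (y t) v - inner ℝ (y t) q)]
    rw [integral_add (hvi.const_mul _) (hyi.const_mul _), integral_const_mul,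
      integral_const_mul] at h3
    have h5 := mul_le_mul_of_nonneg_left (hy.integral_norm_sq_le hω hT hu)
      (by positivity : 0 ≤ 2 * ‖ha.laplace.toL2‖ ^ 2)
    linarith
  have h3 : ‖hb.toL2‖ ^ 2 ≤ ‖ha.toL2‖ ^ 2 := by
    gcongr
    exact ha.norm_mul_planeWave_le e n θ
  have h4 := mul_le_mul_of_nonneg_left (add_le_add h3 h2) (by positivity : 0 ≤ 2 / n ^ 2)
  have h5 : 0 ≤ n ^ 2 * ∫ t in Ioo 0 T, inner ℝ (y t) hb.toL2 ^ 2 :=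
    mul_nonneg (sq_nonneg _) (integral_nonneg fun _ => sq_nonneg _)
  rw [mul_div_right_comm]
  linarith

end IsHeatSolution

end

/-! ### Conclusion -/

theorem proposition2 (N : ℕ) (hN : 1 ≤ N) (Ω : Opens (EuclideanSpace ℝ (Fin N)))
    (hΩc : IsConnected (Ω : Set (EuclideanSpace ℝ (Fin N))))
    (hΩb : Bornology.IsBounded (Ω : Set (EuclideanSpace ℝ (Fin N))))
    (hΩs : HasSmoothBoundary Ω)
    (ω : Set (EuclideanSpace ℝ (Fin N))) (hω : IsOpen ω) (hωΩ : ω ⊆ Ω)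
    (T : ℝ) (hT : 0 < T) :
    ¬ IsFiniteCodimensional (heatReachableUnitBall Ω ω T) := by
  intro hM
  obtain ⟨a, ha, ha0⟩ := exists_isTest_ne_zero hΩc.nonempty
  set e := EuclideanSpace.basisFun (Fin N) ℝ ⟨0, hN⟩
  have he : ‖e‖ = 1 := (EuclideanSpace.basisFun (Fin N) ℝ).norm_eq_one _
  obtain ⟨C, hC⟩ := IsHeatSolution.exists_sq_inner_planeWave_le hω hT ha he
  have hlim : ∀ θ, Filter.Tendsto (fun n : ℕ => ‖(ha.mul_planeWave e n θ).toL2‖ ^ 2) Filter.atTop (nhds 0) := by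
    intro θ
    refine hM.tendsto_norm_sq (ha.tendsto_inner_mul_planeWave he θ)
      (ε := fun n : ℕ => √(C / (n : ℝ) ^ 2)) ?_ ?_
    · have h1 : Filter.Tendsto (fun n : ℕ => C / (n : ℝ) ^ 2) Filter.atTop (nhds 0) :=
        tendsto_const_nhds.div_atTop
          ((Filter.tendsto_pow_atTop two_ne_zero).comp tendsto_natCast_atTop_atTop)
      simpa using h1.sqrt
    · filter_upwards [Filter.eventually_ge_atTop 1] with n hn m hm
      exact Real.abs_le_sqrt (hC m hm n (by exact_mod_cast hn) θ)
  -- One phase alone would not settle it directly; the two together have constant total squared norm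
  -- `‖a‖²`, which would have to be zero.
  have h := (hlim 0).add (hlim (-(Real.pi / 2)))
  simp_rw [ha.norm_sq_mul_planeWave_add] at h
  have h0 := tendsto_nhds_unique h tendsto_const_nhds
  rw [add_zero] at h0
  exact ha0 (norm_eq_zero.1 (pow_eq_zero_iff two_ne_zero |>.1 h0.symm))
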